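/- Let $(X,d)$ be a proper geodesic Gromov hyperbolic metric space. Let $\partial_G X$ be its Gromov boundary (asymptoticity classes of geodesic rays) and $\overline X^G=X\sqcup\partial_GX$ its Gromov compactification. Let $\overline X^H$ be its horofunction compactification, that is, the closure of the image of $i_H\colon X\to C(X)/\{\text{constants}\}$, $i_H(x)=[y\mapsto d(x,y)]$, where $C(X)$ carries the topology of uniform convergence on compact sets. For a non-expanding map $f\colon X\to X$ (i.e. $d(f(x),f(y))\le d(x,y)$), a point $\eta\in\partial_GX$ and a base point $p\in X$, the dilation $\lambda_{\eta,p}(f)\in(0,+\infty]$ is defined by $$\log\lambda_{\eta,p}(f)=\liminf_{z\to\eta,\ z\in X}\bigl(d(z,p)-d(f(z),p)\bigr).$$ The point $\eta$ is a boundary regular fixed point (BRFP) of $f$ if $\lambda_{\eta,p}(f)<+\infty$ (a condition independent of $p$) and $f(x_k)\to\eta$ for every sequence $(x_k)$ in $X$ that converges to $\eta$ and stays within a bounded distance of some geodesic ray with endpoint $\eta$. Suppose that $\overline X^H$ and $\overline X^G$ are equivalent, i.e. there is a homeomorphism $\Phi\colon\overline X^H\to\overline X^G$ with $\Phi\circ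 i_H=\mathrm{id}_X$. Let $f\colon X\to X$ be non-expanding and let $\eta\in\partial_GX$ be a BRFP of $f$. Then $\lambda_{\eta,p}(f)$ does not depend on $p\in X$ (write $\lambda_\eta(f)$ for it), and for all $n\ge 1$ the point $\eta$ is a BRFP of $f^n$ and $$\lambda_\eta(f^n)=\lambda_\eta(f)^n .$$ Hence the limit $\log\Lambda_\eta(f):=\lim_{n\to\infty}\frac1n\log\lambda_{\eta,p}(f^n)$ defining the stable dilation $\Lambda_\eta(f)$ exists for every $p\in X$, and $\Lambda_\eta(f)=\lambda_\eta(f)$. -/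

import Mathlib

open Filter Topology
open scoped NNReal ENNReal

noncomputable section

/-! ### Geodesics and Gromov hyperbolicity -/

/-- `s` is (the image of) a geodesic segment from `x` to `y`. -/
def IsGeodesicSegment {X : Type*} [MetricSpace X] (s : Set X) (x y : X) : Prop :=
  ∃ c : ℝ → X, c 0 = x ∧ c (dist x y) = y ∧
    (∀ t ∈ Set.Icc 0 (dist x y), ∀ u ∈ Set.Icc 0 (dist x y), dist (c t) (c u) = |t - u|) ∧
    s = c '' Set.Icc 0 (dist x y)

/-- A geodesic metric space: any two points are joined by a geodesic segment. -/
def IsGeodesicSpace (X : Type*) [MetricSpace X] : Prop :=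
  ∀ x y : X, ∃ s : Set X, IsGeodesicSegment s x y

/-- `δ`-hyperbolicity: in every geodesic triangle each side lies in the `δ`-neighbourhood of the
union of the other two. (All three sides are covered by permuting the vertices cyclically.) -/
def IsDeltaHyperbolic (X : Type*) [MetricSpace X] (δ : ℝ) : Prop :=
  ∀ (x y z : X) (s₁ s₂ s₃ : Set X),
    IsGeodesicSegment s₁ x y → IsGeodesicSegment s₂ y z → IsGeodesicSegment s₃ z x →
      ∀ u ∈ s₁, ∃ v ∈ s₂ ∪ s₃, dist u v ≤ δ

/-- Gromov hyperbolicity: `δ`-hyperbolicity for some `δ > 0`. -/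
def IsGromovHyperbolic (X : Type*) [MetricSpace X] : Prop :=
  ∃ δ : ℝ, 0 < δ ∧ IsDeltaHyperbolic X δ

/-! ### The Gromov compactification -/

/-- A geodesic ray: an isometric embedding of `[0, ∞)`. -/
def GeodesicRay (X : Type*) [MetricSpace X] : Type _ :=
  {γ : ℝ≥0 → X // Isometry γ}

/-- Two geodesic rays are asymptotic if they stay at bounded distance from each other. -/
def GeodesicRay.Asymptotic {X : Type*} [MetricSpace X] (γ σ : GeodesicRay X) : Prop :=
  ∃ K : ℝ, ∀ t : ℝ≥0, dist (γ.1 t) (σ.1 t) ≤ K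

/-- Being asymptotic is an equivalence relation. -/
def GeodesicRay.asymptoticSetoid (X : Type*) [MetricSpace X] : Setoid (GeodesicRay X) where
  r := GeodesicRay.Asymptotic
  iseqv :=
    { refl := fun γ => ⟨0, fun t => by simp⟩
      symm := fun {_ _} ⟨K, hK⟩ => ⟨K, fun t => by rw [dist_comm]; exact hK t⟩
      trans := fun {_ _ _} ⟨K, hK⟩ ⟨L, hL⟩ =>
        ⟨K + L, fun t => (dist_triangle _ _ _).trans (add_le_add (hK t) (hL t))⟩ }

/-- The Gromov boundary: asymptoticity classes of geodesic rays. -/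
def GromovBoundary (X : Type*) [MetricSpace X] : Type _ :=
  Quotient (GeodesicRay.asymptoticSetoid X)

/-- The class of a geodesic ray in the Gromov boundary (its point at infinity). -/
def GeodesicRay.atInfinity {X : Type*} [MetricSpace X] (γ : GeodesicRay X) : GromovBoundary X :=
  Quotient.mk (GeodesicRay.asymptoticSetoid X) γ

/-- The underlying set `X ⊔ ∂_G X` of the Gromov compactification. -/
inductive GromovCompactification (X : Type*) [MetricSpace X] : Type _
  | of (x : X) : GromovCompactification X
  | bdry (η : GromovBoundary X) : GromovCompactification X

/-- A generalised ray issuing from `p`: either a geodesic ray (`len = ∞`), or a geodesic segment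
of length `len < ∞` extended to `[0, ∞)` by its final value. -/
structure GeneralizedRay (X : Type*) [MetricSpace X] (p : X) where
  toMap : C(ℝ≥0, X)
  len : ℝ≥0∞
  start : toMap 0 = p
  dist_eq : ∀ s t : ℝ≥0, (s : ℝ≥0∞) ≤ len → (t : ℝ≥0∞) ≤ len →
    dist (toMap s) (toMap t) = dist s t
  eq_last : ∀ t : ℝ≥0, len ≤ (t : ℝ≥0∞) → toMap t = toMap len.toNNReal

/-- Generalised rays carry the topology of uniform convergence on compact sets. -/
instance (X : Type*) [MetricSpace X] (p : X) : TopologicalSpace (GeneralizedRay X p) :=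
  TopologicalSpace.induced GeneralizedRay.toMap inferInstance

open Classical in
/-- The endpoint of a generalised ray: the class at infinity of a geodesic ray, or the last
point of a segment. -/
def GeneralizedRay.endpoint {X : Type*} [MetricSpace X] {p : X} (c : GeneralizedRay X p) :
    GromovCompactification X :=
  if h : c.len = ⊤ then
    GromovCompactification.bdry (GeodesicRay.atInfinity
      ⟨c.toMap, Isometry.of_dist_eq fun s t => c.dist_eq s t (by simp [h]) (by simp [h])⟩)
  else GromovCompactification.of (c.toMap c.len.toNNReal)

/-- The topology of the Gromov compactification. For a base point `p`, the standard topology on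
`X ⊔ ∂_G X` is the quotient topology under the endpoint map from the generalised rays issuing
from `p`: a set `B` is closed iff `c(∞) ∈ B` whenever generalised rays `c_n` from `p` with
`c_n(∞) ∈ B` converge to `c` uniformly on compact sets. In a proper geodesic Gromov hyperbolic
space it does not depend on `p`; to avoid singling out a base point we call a set open if it is
open for every `p` (this is what the supremum of topologies means). -/
instance (X : Type*) [MetricSpace X] : TopologicalSpace (GromovCompactification X) :=
  ⨆ p : X, TopologicalSpace.coinduced
    (GeneralizedRay.endpoint : GeneralizedRay X p → GromovCompactification X) inferInstance

/-! ### The horofunction compactification -/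

/-- `C_*(X)`: real continuous functions (topology of uniform convergence on compact sets)
modulo the constant functions. -/
abbrev FunctionsModConstants (X : Type*) [MetricSpace X] : Type _ :=
  C(X, ℝ) ⧸ (Submodule.span ℝ {(1 : C(X, ℝ))})

/-- The map `i_H`, sending `x` to the class of `y ↦ d(x, y)`. -/
def horoEmbedding {X : Type*} [MetricSpace X] (x : X) : FunctionsModConstants X :=
  Submodule.Quotient.mk (⟨fun y => dist x y, by fun_prop⟩ : C(X, ℝ))

/-- The horofunction compactification: the closure of `i_H(X)` in `C_*(X)`. -/
abbrev HorofunctionCompactification (X : Type*) [MetricSpace X] : Type _ :=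
  closure (Set.range (horoEmbedding : X → FunctionsModConstants X))

/-- The horofunction and Gromov compactifications are equivalent: there is a homeomorphism
between them that restricts to the identity of `X`. -/
def CompactificationsEquivalent (X : Type*) [MetricSpace X] : Prop :=
  ∃ Φ : HorofunctionCompactification X ≃ₜ GromovCompactification X,
    ∀ x : X, Φ ⟨horoEmbedding x, subset_closure (Set.mem_range_self x)⟩ =
      GromovCompactification.of x

/-! ### Dilation, geodesic limits, boundary regular fixed points -/

/-- The filter `z → η`, with `z` in `X`. -/
def toBoundary {X : Type*} [MetricSpace X] (η : GromovBoundary X) : Filter X :=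
  comap GromovCompactification.of (𝓝 (GromovCompactification.bdry η))

/-- `log λ_{η,p}(f) = liminf_{z → η} (d(z,p) - d(f(z),p))`, in the extended reals. -/
def logDilation {X : Type*} [MetricSpace X] (f : X → X) (η : GromovBoundary X) (p : X) : EReal :=
  liminf (fun z : X => ((dist z p - dist (f z) p : ℝ) : EReal)) (toBoundary η)

/-- The dilation `λ_{η,p}(f)` of `f` at `η` with respect to the base point `p`. -/
def dilation {X : Type*} [MetricSpace X] (f : X → X) (η : GromovBoundary X) (p : X) : ℝ≥0∞ :=
  EReal.exp (logDilation f η p)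

/-- The geodesic region `A(γ, R)`. -/
def geodesicRegion {X : Type*} [MetricSpace X] (γ : GeodesicRay X) (R : ℝ) : Set X :=
  {x | Metric.infDist x (Set.range γ.1) < R}

/-- `g : X → Y` has geodesic limit `ξ` at `η`: `g(x_n) → ξ` for every sequence `x_n → η`
contained in a geodesic region with vertex `η`. -/
def HasGeodesicLimit {X Y : Type*} [MetricSpace X] [TopologicalSpace Y] (g : X → Y)
    (η : GromovBoundary X) (ξ : Y) : Prop :=
  ∀ (γ : GeodesicRay X) (R : ℝ), 0 < R → γ.atInfinity = η →
    ∀ x : ℕ → X, (∀ n, x n ∈ geodesicRegion γ R) → Tendsto x atTop (toBoundary η) →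
      Tendsto (fun n => g (x n)) atTop (𝓝 ξ)

/-- `η` is a boundary regular fixed point of `f`: the dilation of `f` at `η` is finite (for
non-expanding `f` this does not depend on the base point) and `f` has geodesic limit `η` at
`η`. -/
def IsBRFP {X : Type*} [MetricSpace X] (f : X → X) (η : GromovBoundary X) : Prop :=
  (∃ p : X, dilation f η p < ⊤) ∧
    HasGeodesicLimit (fun x => GromovCompactification.of (f x)) η (GromovCompactification.bdry η)

/-- The stable dilation `Λ_η(f)`, given by `log Λ_η(f) = lim_n (log λ_{η,p}(f^n)) / n`. It is
meaningful only if the limit exists. -/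
def stableDilation {X : Type*} [MetricSpace X] (f : X → X) (η : GromovBoundary X) (p : X) :
    ℝ≥0∞ :=
  EReal.exp (limUnder atTop fun n : ℕ => logDilation f^[n] η p / (n : EReal))

end

/-! ### Generalised rays -/

/-! Equivalence of the compactifications attaches to `η` a single horofunction `H`, unique up to
constants: `d(z, x) - d(z, p) → H x - H p` however `z → η` (`exists_horofunction`). The key fact is
`logDilation_le_iff`: `log λ` is the least `C` with `H ∘ f ≤ H + C`. This condition ignores the base
point, and iterating it bounds `log λ(f^n)` above by `n log λ(f)`.

For the lower bound, let `γ` be a ray from `p` to `η`. The loss `d(γ(m), p) - d(f^n(γ(m)), p)`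
telescopes into the losses of `f` at `f^k(γ(m))`, `k < n`. These points tend to `η`, so each term
eventually exceeds any `a < log λ(f)`, while the sum is at most any `C` with `H ∘ f^n ≤ H + C`.

Both bounds need the geodesic limits of the iterates, which is where hyperbolicity enters. Since `H`
drops at unit speed along `γ`, the path `f^n ∘ γ` escapes at unit speed up to a constant, hence
stays near a ray to `η` (`exists_ray_close_to_path`). So `f^n` maps geodesic regions at `η` into
geodesic regions at `η`. -/

theorem ContinuousMap.tendsto_of_lipschitz_of_pointwise {ι Y Z : Type*} [MetricSpace Y]
    [MetricSpace Z] {l : Filter ι} {F : ι → C(Y, Z)} {f : C(Y, Z)}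
    (hF : ∀ i, LipschitzWith 1 (F i)) (hf : LipschitzWith 1 f)
    (h : ∀ y, Tendsto (fun i => F i y) l (𝓝 (f y))) : Tendsto F l (𝓝 f) := by
  refine ContinuousMap.tendsto_of_tendstoLocallyUniformly
    (Metric.tendstoLocallyUniformly_iff.2 fun ε hε x => ?_)
  refine ⟨Metric.ball x (ε / 3), Metric.ball_mem_nhds x (by positivity), ?_⟩
  filter_upwards [Metric.tendsto_nhds.1 (h x) (ε / 3) (by positivity)] with i hi y hy
  have h1 : dist (f y) (f x) ≤ dist y x := by simpa using hf.dist_le_mul y x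
  have h2 : dist (F i x) (F i y) ≤ dist x y := by simpa using (hF i).dist_le_mul x y
  have h3 := dist_triangle4 (f y) (f x) (F i x) (F i y)
  rw [dist_comm (f x) (F i x)] at h3
  rw [dist_comm x y] at h2
  have := Metric.mem_ball.1 hy
  linarith

theorem GeneralizedRay.continuous_endpoint {X : Type*} [MetricSpace X] (p : X) :
    Continuous (GeneralizedRay.endpoint : GeneralizedRay X p → GromovCompactification X) :=
  continuous_iff_coinduced_le.2 <| le_iSup (fun p : X => TopologicalSpace.coinduced
    (GeneralizedRay.endpoint : GeneralizedRay X p → GromovCompactification X) inferInstance) p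

theorem GeneralizedRay.tendsto_iff {X ι : Type*} [MetricSpace X] {p : X} {l : Filter ι}
    {c : ι → GeneralizedRay X p} {c₀ : GeneralizedRay X p} :
    Tendsto c l (𝓝 c₀) ↔ Tendsto (fun i => (c i).toMap) l (𝓝 c₀.toMap) := by
  rw [nhds_induced, tendsto_comap_iff]; rfl

/-- A geodesic of length at least `d`, stopped at time `d`. -/
theorem exists_generalizedRay_of_isometryOn {X : Type*} [MetricSpace X] (c : ℝ≥0 → X) (d : ℝ≥0)
    (hc : ∀ s ≤ d, ∀ t ≤ d, dist (c s) (c t) = dist s t) :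
    ∃ r : GeneralizedRay X (c 0), LipschitzWith 1 r.toMap ∧ (∀ t, r.toMap t = c (min t d)) ∧
      r.len = d ∧ r.endpoint = GromovCompactification.of (c d) := by
  have hlip : LipschitzWith 1 fun t : ℝ≥0 => c (min t d) := by
    refine LipschitzWith.of_dist_le_mul fun s t => ?_
    rw [hc _ (min_le_right _ _) _ (min_le_right _ _), NNReal.coe_one, one_mul]
    simp only [NNReal.dist_eq, NNReal.coe_min]
    simpa using abs_min_sub_min_le_max (s : ℝ) d t d
  refine ⟨⟨⟨_, hlip.continuous⟩, d, by simp, fun s t hs ht => ?_, fun t ht => ?_⟩, hlip,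
    fun t => rfl, rfl, ?_⟩
  · have hs' : s ≤ d := by exact_mod_cast hs
    have ht' : t ≤ d := by exact_mod_cast ht
    simpa [hs', ht'] using hc s hs' t ht'
  · have ht' : d ≤ t := by exact_mod_cast ht
    simp [ht']
  · simp [GeneralizedRay.endpoint]

/-- The generalised ray of infinite length given by a geodesic ray. -/
def GeodesicRay.toGeneralizedRay {X : Type*} [MetricSpace X] (γ : GeodesicRay X) :
    GeneralizedRay X (γ.1 0) where
  toMap := ⟨γ.1, γ.2.continuous⟩
  len := ⊤
  start := rfl
  dist_eq s t _ _ := γ.2.dist_eq s t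
  eq_last t ht := absurd ht (by simp)

theorem GeodesicRay.endpoint_toGeneralizedRay {X : Type*} [MetricSpace X] (γ : GeodesicRay X) :
    γ.toGeneralizedRay.endpoint = GromovCompactification.bdry γ.atInfinity := by
  simp only [GeneralizedRay.endpoint, GeodesicRay.toGeneralizedRay]
  rfl

/-- The truncations of `γ` at time `d` eventually agree with `γ` at each fixed time, so they
converge to it as generalised rays, and the endpoint map is continuous. -/
theorem GeodesicRay.tendsto_toBoundary {X : Type*} [MetricSpace X] (γ : GeodesicRay X) :
    Tendsto γ.1 atTop (toBoundary γ.atInfinity) := by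
  rw [toBoundary, tendsto_comap_iff]
  choose r hlip hr _ hend using fun d : ℝ≥0 =>
    exists_generalizedRay_of_isometryOn γ.1 d fun s _ t _ => γ.2.dist_eq s t
  have h : Tendsto r atTop (𝓝 γ.toGeneralizedRay) := by
    refine GeneralizedRay.tendsto_iff.2
      (ContinuousMap.tendsto_of_lipschitz_of_pointwise hlip γ.2.lipschitz fun t => ?_)
    refine tendsto_const_nhds.congr' ?_
    filter_upwards [eventually_ge_atTop t] with d hd
    rw [hr, min_eq_left hd]
    rfl
  have h' := ((GeneralizedRay.continuous_endpoint (γ.1 0)).tendsto _).comp h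
  rw [γ.endpoint_toGeneralizedRay] at h'
  exact h'.congr fun d => hend d

instance toBoundary_neBot {X : Type*} [MetricSpace X] (η : GromovBoundary X) :
    (toBoundary η).NeBot := by
  obtain ⟨γ, rfl⟩ := Quotient.exists_rep η
  exact (GeodesicRay.tendsto_toBoundary γ).neBot

/-- Generalised rays from `p` whose lengths tend to infinity converge to a geodesic ray along
every ultrafilter. -/
theorem GeneralizedRay.exists_limit {X ι : Type*} [MetricSpace X] [ProperSpace X]
    (𝒰 : Ultrafilter ι) {p : X} (c : ι → GeneralizedRay X p)
    (hlip : ∀ i, LipschitzWith 1 (c i).toMap) (hlen : Tendsto (fun i => (c i).len) 𝒰 (𝓝 ⊤)) :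
    ∃ σ : GeodesicRay X, σ.1 0 = p ∧ (∀ t, Tendsto (fun i => (c i).toMap t) 𝒰 (𝓝 (σ.1 t))) ∧
      Tendsto (fun i => (c i).endpoint) 𝒰 (𝓝 (GromovCompactification.bdry σ.atInfinity)) := by
  -- The ultrafilter replaces Arzelà–Ascoli: properness gives limits at each time, and the common
  -- Lipschitz bound makes the convergence locally uniform.
  have hlim : ∀ t : ℝ≥0, ∃ x, Tendsto (fun i => (c i).toMap t) 𝒰 (𝓝 x) := fun t => by
    have hmem : Metric.closedBall p t ∈ 𝒰.map fun i => (c i).toMap t := by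
      refine Ultrafilter.mem_map.2 (univ_mem' fun i => ?_)
      have := (hlip i).dist_le_mul t 0
      rw [(c i).start] at this
      simpa [NNReal.dist_eq] using this
    obtain ⟨x, -, hx⟩ := (isCompact_closedBall p (t : ℝ)).ultrafilter_le_nhds' _ hmem
    exact ⟨x, hx⟩
  choose σ hσ using hlim
  have hiso : Isometry σ := Isometry.of_dist_eq fun s t => by
    refine tendsto_nhds_unique ((hσ s).dist (hσ t)) (tendsto_const_nhds.congr' ?_)
    filter_upwards [hlen.eventually (lt_mem_nhds (ENNReal.coe_lt_top (r := s))),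
      hlen.eventually (lt_mem_nhds (ENNReal.coe_lt_top (r := t)))] with i hs ht
    exact ((c i).dist_eq s t hs.le ht.le).symm
  have h0 : σ 0 = p := tendsto_nhds_unique (hσ 0) (by simp [(c _).start])
  subst h0
  let γ : GeodesicRay X := ⟨σ, hiso⟩
  refine ⟨γ, rfl, hσ, ?_⟩
  have h : Tendsto c 𝒰 (𝓝 γ.toGeneralizedRay) :=
    GeneralizedRay.tendsto_iff.2
      (ContinuousMap.tendsto_of_lipschitz_of_pointwise hlip γ.2.lipschitz hσ)
  have h' := ((GeneralizedRay.continuous_endpoint (γ.1 0)).tendsto _).comp h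
  rwa [γ.endpoint_toGeneralizedRay] at h'

/-! ### Consequences of the equivalence of the compactifications -/

/-- Evaluation of the differences `g x - g p` on functions modulo constants. -/
def evalSub {X : Type*} [MetricSpace X] (x p : X) : FunctionsModConstants X → ℝ :=
  Submodule.liftQ (Submodule.span ℝ {(1 : C(X, ℝ))})
    ((ContinuousMap.evalCLM ℝ x - ContinuousMap.evalCLM ℝ p : C(X, ℝ) →L[ℝ] ℝ) : C(X, ℝ) →ₗ[ℝ] ℝ)
    (by simp [Submodule.span_le])

theorem continuous_evalSub {X : Type*} [MetricSpace X] (x p : X) :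
    Continuous (evalSub x p) :=
  continuous_quot_lift _
    (ContinuousMap.evalCLM ℝ x - ContinuousMap.evalCLM ℝ p : C(X, ℝ) →L[ℝ] ℝ).continuous

theorem evalSub_horoEmbedding {X : Type*} [MetricSpace X] (x p z : X) :
    evalSub x p (horoEmbedding z) = dist z x - dist z p := rfl

theorem continuous_horoEmbedding {X : Type*} [MetricSpace X] :
    Continuous (horoEmbedding : X → FunctionsModConstants X) := by
  have h : Continuous fun x : X => (⟨fun y => dist x y, by fun_prop⟩ : C(X, ℝ)) :=
    (ContinuousMap.curry ⟨fun q : X × X => dist q.1 q.2, by fun_prop⟩).continuous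
  exact continuous_quot_mk.comp h

/-- The constants form a closed subspace, so the quotient is Hausdorff, and `Φ` transports this. It
is what makes endpoints of limit rays unique. -/
theorem CompactificationsEquivalent.t2Space {X : Type*} [MetricSpace X]
    (h : CompactificationsEquivalent X) : T2Space (GromovCompactification X) := by
  obtain ⟨Φ, -⟩ := h
  have : IsClosed ((Submodule.span ℝ {(1 : C(X, ℝ))} : Submodule ℝ C(X, ℝ)) : Set C(X, ℝ)) :=
    Submodule.closed_of_finiteDimensional _
  have : T2Space (FunctionsModConstants X) := inferInstance
  exact Φ.t2Space

theorem CompactificationsEquivalent.continuous_of {X : Type*} [MetricSpace X]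
    (h : CompactificationsEquivalent X) :
    Continuous (GromovCompactification.of : X → GromovCompactification X) := by
  obtain ⟨Φ, hΦ⟩ := h
  exact (Φ.continuous.comp (continuous_horoEmbedding.subtype_mk _)).congr hΦ

/-- `H` is a horofunction at `η`: the differences `H x - H p` are the limits of
`d(z, x) - d(z, p)` as `z → η`. -/
def IsHorofunctionAt {X : Type*} [MetricSpace X] (H : X → ℝ) (η : GromovBoundary X) : Prop :=
  ∀ x p, Tendsto (fun z => dist z x - dist z p) (toBoundary η) (𝓝 (H x - H p))

theorem CompactificationsEquivalent.exists_horofunction {X : Type*} [MetricSpace X]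
    (h : CompactificationsEquivalent X) (η : GromovBoundary X) :
    ∃ H : X → ℝ, IsHorofunctionAt H η := by
  obtain ⟨Φ, hΦ⟩ := h
  obtain ⟨H, hH⟩ := Submodule.Quotient.mk_surjective _ (Φ.symm (GromovCompactification.bdry η)).1
  refine ⟨H, fun x p => ?_⟩
  have h1 : Tendsto (fun z : X => (Φ.symm (GromovCompactification.of z)).1) (toBoundary η)
      (𝓝 (Submodule.Quotient.mk H)) := by
    rw [hH]
    exact (continuous_subtype_val.comp Φ.symm.continuous).continuousAt.tendsto.comp tendsto_comap
  refine (((continuous_evalSub x p).tendsto _).comp h1).congr fun z => ?_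
  rw [Function.comp_apply, ← hΦ z, Φ.symm_apply_apply, evalSub_horoEmbedding]

/-- A compact subset of `X` has compact, hence closed, image, and this image misses `η`. -/
theorem CompactificationsEquivalent.toBoundary_le_cocompact {X : Type*} [MetricSpace X]
    (h : CompactificationsEquivalent X) (η : GromovBoundary X) : toBoundary η ≤ cocompact X := by
  have := h.t2Space
  intro s hs
  obtain ⟨K, hK, hKs⟩ := mem_cocompact.1 hs
  refine ⟨(GromovCompactification.of '' K)ᶜ, ?_, ?_⟩
  · exact (hK.image h.continuous_of).isClosed.isOpen_compl.mem_nhds (by simp)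
  · exact fun x hx => hKs fun hxK => hx ⟨x, hxK, rfl⟩

/-- Segments from `p` to points converging to `η` subconverge to a ray from `p` to `η`. -/
theorem exists_ray_limit {X ι : Type*} [MetricSpace X] [ProperSpace X] (hgeod : IsGeodesicSpace X)
    (hequiv : CompactificationsEquivalent X) {η : GromovBoundary X} (p : X) (𝒰 : Ultrafilter ι)
    {z : ι → X} (hz : Tendsto z 𝒰 (toBoundary η)) :
    ∃ (c : ι → ℝ≥0 → X) (σ : GeodesicRay X), σ.1 0 = p ∧ σ.atInfinity = η ∧
      (∀ i, c i 0 = p ∧ c i (nndist p (z i)) = z i ∧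
        ∀ s ≤ nndist p (z i), ∀ t ≤ nndist p (z i), dist (c i s) (c i t) = dist s t) ∧
      ∀ t, Tendsto (fun i => c i t) 𝒰 (𝓝 (σ.1 t)) := by
  have := hequiv.t2Space
  have hseg : ∀ y : X, ∃ c : ℝ≥0 → X, c 0 = p ∧ c (nndist p y) = y ∧
      ∀ s ≤ nndist p y, ∀ t ≤ nndist p y, dist (c s) (c t) = dist s t := fun y => by
    obtain ⟨_, c, h0, h1, hc, -⟩ := hgeod p y
    exact ⟨fun t => c t, h0, h1, fun s hs t ht => hc s ⟨s.2, hs⟩ t ⟨t.2, ht⟩⟩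
  choose c h0 h1 hc using fun i => hseg (z i)
  have hr : ∀ i, ∃ r : GeneralizedRay X p, LipschitzWith 1 r.toMap ∧
      (∀ t, r.toMap t = c i (min t (nndist p (z i)))) ∧ r.len = nndist p (z i) ∧
      r.endpoint = GromovCompactification.of (z i) := fun i => by
    have := exists_generalizedRay_of_isometryOn (c i) _ (hc i)
    rwa [h0, h1] at this
  choose r hlip hr hlen hend using hr
  have hinf : Tendsto (fun i => nndist p (z i)) 𝒰 atTop := by
    have := (tendsto_dist_left_cocompact_atTop p).comp
      (hz.mono_right (hequiv.toBoundary_le_cocompact η))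
    exact NNReal.tendsto_coe_atTop.1 this
  obtain ⟨σ, hσ0, hσ, hσend⟩ := GeneralizedRay.exists_limit 𝒰 r hlip (by
    simp only [hlen]
    exact ENNReal.tendsto_coe_nhds_top.2 hinf)
  refine ⟨c, σ, hσ0, ?_, fun i => ⟨h0 i, h1 i, hc i⟩, fun t => (hσ t).congr' ?_⟩
  -- The endpoints `z i` tend both to `η` and to the class of `σ`; the Hausdorff property identifies
  -- the two.
  · simp only [hend] at hσend
    have := tendsto_nhds_unique hσend (tendsto_comap_iff.1 hz)
    simpa using this
  · filter_upwards [hinf.eventually_ge_atTop t] with i hi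
    rw [hr, min_eq_left hi]

/-! ### Thin triangles -/

theorem IsGeodesicSegment.isCompact_isConnected {X : Type*} [MetricSpace X] {s : Set X} {x y : X}
    (h : IsGeodesicSegment s x y) : IsCompact s ∧ IsConnected s := by
  obtain ⟨c, -, -, hc, rfl⟩ := h
  have hcont : ContinuousOn c (Set.Icc 0 (dist x y)) :=
    (LipschitzOnWith.of_dist_le_mul (K := 1) fun t ht u hu => by
      simpa [Real.dist_eq] using (hc t ht u hu).le).continuousOn
  exact ⟨isCompact_Icc.image_of_continuousOn hcont, (isConnected_Icc dist_nonneg).image _ hcont⟩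

theorem IsGeodesicSegment.left_mem {X : Type*} [MetricSpace X] {s : Set X} {x y : X}
    (h : IsGeodesicSegment s x y) : x ∈ s := by
  obtain ⟨c, h0, -, -, rfl⟩ := h
  exact ⟨0, ⟨le_rfl, dist_nonneg⟩, h0⟩

theorem IsGeodesicSegment.right_mem {X : Type*} [MetricSpace X] {s : Set X} {x y : X}
    (h : IsGeodesicSegment s x y) : y ∈ s := by
  obtain ⟨c, -, h1, -, rfl⟩ := h
  exact ⟨_, ⟨dist_nonneg, le_rfl⟩, h1⟩

theorem IsGeodesicSegment.dist_add_dist {X : Type*} [MetricSpace X] {s : Set X} {x y v : X}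
    (h : IsGeodesicSegment s x y) (hv : v ∈ s) : dist x v + dist v y = dist x y := by
  obtain ⟨c, h0, h1, hc, rfl⟩ := h
  obtain ⟨t, ht, rfl⟩ := hv
  have e0 := hc 0 ⟨le_rfl, dist_nonneg⟩ t ht
  have e1 := hc t ht _ ⟨dist_nonneg, le_rfl⟩
  rw [h0, zero_sub, abs_neg, abs_of_nonneg ht.1] at e0
  rw [h1, abs_of_nonpos (by linarith [ht.2])] at e1
  linarith

/-- In a hyperbolic space, a point almost realising the distance from `p` to `w` is close to
every segment from `p` to `w`. -/
theorem IsDeltaHyperbolic.exists_dist_le {X : Type*} [MetricSpace X] {δ C : ℝ}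
    (hδ : IsDeltaHyperbolic X δ) (hgeod : IsGeodesicSpace X) {p w y : X} {s : Set X}
    (hs : IsGeodesicSegment s p w) (hy : dist p y + dist y w ≤ dist p w + C) (hδ0 : 0 ≤ δ) :
    ∃ u ∈ s, dist u y ≤ C + 3 * δ := by
  obtain ⟨s₂, h₂⟩ := hgeod w y
  obtain ⟨s₃, h₃⟩ := hgeod y p
  have hcov : s ⊆ {u | Metric.infDist u s₂ ≤ δ} ∪ {u | Metric.infDist u s₃ ≤ δ} := by
    intro u hu
    obtain ⟨v, hv | hv, hd⟩ := hδ p w y s s₂ s₃ hs h₂ h₃ u hu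
    · exact Or.inl ((Metric.infDist_le_dist_of_mem hv).trans hd)
    · exact Or.inr ((Metric.infDist_le_dist_of_mem hv).trans hd)
  -- The side `s` is connected and covered by two closed sets, one containing `w` and the other `p`,
  -- so some `u` is `δ`-close to both other sides.
  obtain ⟨u, hu, hu₂, hu₃⟩ :=
    isPreconnected_closed_iff.1 hs.isCompact_isConnected.2.isPreconnected _ _
      (isClosed_le (Metric.continuous_infDist_pt _) continuous_const)
      (isClosed_le (Metric.continuous_infDist_pt _) continuous_const) hcov
      ⟨w, hs.right_mem, by simpa [Metric.infDist_zero_of_mem h₂.left_mem] using hδ0⟩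
      ⟨p, hs.left_mem, by simpa [Metric.infDist_zero_of_mem h₃.right_mem] using hδ0⟩
  obtain ⟨v₂, hv₂, e₂⟩ := h₂.isCompact_isConnected.1.exists_infDist_eq_dist ⟨_, h₂.left_mem⟩ u
  obtain ⟨v₃, hv₃, e₃⟩ := h₃.isCompact_isConnected.1.exists_infDist_eq_dist ⟨_, h₃.left_mem⟩ u
  rw [Set.mem_ofPred_eq, e₂] at hu₂
  rw [Set.mem_ofPred_eq, e₃] at hu₃
  refine ⟨u, hu, ?_⟩
  have a₂ := h₂.dist_add_dist hv₂
  have a₃ := h₃.dist_add_dist hv₃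
  have b := hs.dist_add_dist hu
  have t₁ := dist_triangle u v₂ y
  have t₂ := dist_triangle w v₂ u
  have t₃ := dist_triangle u v₃ p
  have t₄ := dist_nonneg (x := v₃) (y := y)
  have t₅ := dist_nonneg (x := u) (y := y)
  have t₆ := dist_triangle u v₃ y
  simp only [dist_comm y w, dist_comm p y, dist_comm v₂ u, dist_comm p u, dist_comm w u,
    dist_comm y v₃] at *
  linarith

/-- A `1`-Lipschitz path to `η` which escapes at unit speed up to an additive constant stays at
bounded distance from a geodesic ray with endpoint `η`. -/
theorem exists_ray_close_to_path {X : Type*} [MetricSpace X] [ProperSpace X]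
    (hgeod : IsGeodesicSpace X) (hhyp : IsGromovHyperbolic X)
    (hequiv : CompactificationsEquivalent X) {η : GromovBoundary X} {y : ℝ≥0 → X}
    (hy : LipschitzWith 1 y) {p : X} {C : ℝ} (hC : ∀ t : ℝ≥0, t - dist (y t) p ≤ C)
    (hlim : Tendsto (fun n : ℕ => y n) atTop (toBoundary η)) :
    ∃ (σ : GeodesicRay X) (K : ℝ), σ.atInfinity = η ∧ ∀ t, ∃ s, dist (y t) (σ.1 s) ≤ K := by
  obtain ⟨δ, hδ0, hδ⟩ := hhyp
  obtain ⟨c, σ, -, hση, hc, hcσ⟩ := exists_ray_limit hgeod hequiv p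
    (Ultrafilter.of (atTop : Filter ℕ)) (hlim.mono_left (Ultrafilter.of_le _))
  -- The path almost realises `d(p, y n)`, with excess `C + d(p, y 0)`, so thin triangles put `y t`
  -- near the segment to `y n`. Moving to the segment's point at distance `d(p, y t)` from `p` at
  -- most doubles the error.
  refine ⟨σ, 2 * (C + dist p (y 0) + 3 * δ), hση, fun t => ⟨nndist p (y t), ?_⟩⟩
  refine le_of_tendsto (tendsto_const_nhds.dist (hcσ _)) (Ultrafilter.of_le _ ?_)
  filter_upwards [(tendsto_natCast_atTop_atTop (R := ℝ)).eventually_ge_atTop (t : ℝ),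
    (tendsto_natCast_atTop_atTop (R := ℝ)).eventually_ge_atTop (dist p (y t) + C)] with n hn hn'
  obtain ⟨h0, h1, hiso⟩ := hc n
  have e1 : dist p (y t) ≤ dist p (y 0) + t := by
    have := hy.dist_le_mul 0 t
    simp [NNReal.dist_eq] at this
    linarith [dist_triangle p (y 0) (y t)]
  have e2 : dist (y t) (y n) ≤ n - t := by
    have := hy.dist_le_mul t n
    simp only [NNReal.coe_one, one_mul, NNReal.dist_eq, NNReal.coe_natCast] at this
    rwa [abs_sub_comm, abs_of_nonneg (by linarith)] at this
  have e3 := hC n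
  rw [NNReal.coe_natCast, dist_comm] at e3
  have hseg : IsGeodesicSegment (c n '' Set.Iic (nndist p (y n))) p (y n) := by
    refine ⟨fun r => c n r.toNNReal, by simpa using h0, ?_, fun r hr u hu => ?_, ?_⟩
    · simpa only [dist_nndist, Real.toNNReal_coe] using h1
    · rw [hiso _ (Real.toNNReal_le_iff_le_coe.2 hr.2) _ (Real.toNNReal_le_iff_le_coe.2 hu.2),
        NNReal.dist_eq, Real.coe_toNNReal _ hr.1, Real.coe_toNNReal _ hu.1]
    · ext v
      constructor
      · rintro ⟨r, hr, rfl⟩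
        exact ⟨r, ⟨r.2, hr⟩, by simp⟩
      · rintro ⟨r, hr, rfl⟩
        exact ⟨_, Real.toNNReal_le_iff_le_coe.2 hr.2, rfl⟩
  obtain ⟨_, ⟨r, hr, rfl⟩, hu⟩ := hδ.exists_dist_le hgeod hseg (y := y t)
    (C := C + dist p (y 0)) (by linarith) hδ0.le
  have hle : nndist p (y t) ≤ nndist p (y n) := by
    rw [← NNReal.coe_le_coe, coe_nndist, coe_nndist]
    linarith
  have e4 : dist p (c n r) = r := by
    have := hiso 0 (zero_le) r hr
    simpa [h0, NNReal.dist_eq] using this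
  have e5 := hiso r hr _ hle
  have e6 : dist r (nndist p (y t)) ≤ dist (c n r) (y t) := by
    rw [NNReal.dist_eq, coe_nndist, ← e4, dist_comm p, dist_comm p]
    exact abs_dist_sub_le _ _ _
  have e7 := dist_triangle (y t) (c n r) (c n (nndist p (y t)))
  rw [dist_comm (y t) (c n r)] at e7
  linarith

/-! ### Horofunctions and dilations -/

theorem IsHorofunctionAt.sub_le_dist {X : Type*} [MetricSpace X] {H : X → ℝ}
    {η : GromovBoundary X} (hH : IsHorofunctionAt H η) (x p : X) : H x - H p ≤ dist x p :=
  le_of_tendsto (hH x p) (Eventually.of_forall fun z => by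
    linarith [dist_triangle z p x, dist_comm x p])

theorem IsHorofunctionAt.apply_ray {X : Type*} [MetricSpace X] {H : X → ℝ}
    {η : GromovBoundary X} (hH : IsHorofunctionAt H η) {γ : GeodesicRay X}
    (hγ : γ.atInfinity = η) (t : ℝ≥0) : H (γ.1 t) - H (γ.1 0) = -t := by
  subst hγ
  refine tendsto_nhds_unique ((hH (γ.1 t) (γ.1 0)).comp γ.tendsto_toBoundary)
    (tendsto_const_nhds.congr' ?_)
  filter_upwards [eventually_ge_atTop t] with s hs
  have hs' : (t : ℝ) ≤ s := hs
  simp only [Function.comp_apply, γ.2.dist_eq, NNReal.dist_eq, NNReal.coe_zero, sub_zero,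
    NNReal.abs_eq]
  rw [abs_of_nonneg (by linarith)]
  ring

/-- If `H ∘ g ≤ H + C`, the rays to `η` lose at most `C` under `g`. -/
theorem IsHorofunctionAt.sub_dist_le {X : Type*} [MetricSpace X] {H : X → ℝ}
    {η : GromovBoundary X} (hH : IsHorofunctionAt H η) {g : X → X} {C : ℝ}
    (hg : ∀ x, H (g x) ≤ H x + C) {γ : GeodesicRay X} (hγ : γ.atInfinity = η) (t : ℝ≥0) :
    t - dist (g (γ.1 t)) (γ.1 0) ≤ C := by
  have h1 := hH.apply_ray hγ t
  have h2 := hH.sub_le_dist (γ.1 0) (g (γ.1 t))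
  rw [dist_comm] at h2
  linarith [hg (γ.1 t)]

/-- **Julia's lemma** along a filter. -/
theorem IsHorofunctionAt.apply_le {X ι : Type*} [MetricSpace X] {H : X → ℝ}
    {η : GromovBoundary X} (hH : IsHorofunctionAt H η) {f : X → X} (hf : LipschitzWith 1 f)
    {l : Filter ι} [l.NeBot] {w : ι → X} {p : X} {C : ℝ} (hw : Tendsto w l (toBoundary η))
    (hfw : Tendsto (fun i => f (w i)) l (toBoundary η))
    (hC : ∀ i, dist (w i) p - dist (f (w i)) p ≤ C) (x : X) : H (f x) ≤ H x + C := by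
  have := le_of_tendsto_of_tendsto' ((hH (f x) p).comp hfw) (((hH x p).comp hw).add_const C)
    fun i => by
      have h : dist (f (w i)) (f x) ≤ dist (w i) x := by simpa using hf.dist_le_mul (w i) x
      simp only [Function.comp_apply]
      linarith [hC i]
  linarith

theorem exists_ray {X : Type*} [MetricSpace X] [ProperSpace X] (hgeod : IsGeodesicSpace X)
    (hequiv : CompactificationsEquivalent X) (η : GromovBoundary X) (p : X) :
    ∃ γ : GeodesicRay X, γ.1 0 = p ∧ γ.atInfinity = η := by
  obtain ⟨-, γ, h0, hγ, -⟩ := exists_ray_limit hgeod hequiv p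
    (Ultrafilter.of (toBoundary η)) (z := id) (tendsto_id'.2 (Ultrafilter.of_le _))
  exact ⟨γ, h0, hγ⟩

theorem HasGeodesicLimit.tendsto_ray {X : Type*} [MetricSpace X] {g : X → X}
    {η : GromovBoundary X}
    (hg : HasGeodesicLimit (fun x => GromovCompactification.of (g x)) η
      (GromovCompactification.bdry η)) {γ : GeodesicRay X} (hγ : γ.atInfinity = η) :
    Tendsto (fun n : ℕ => g (γ.1 n)) atTop (toBoundary η) := by
  refine tendsto_comap_iff.2 (hg γ 1 one_pos hγ (fun n => γ.1 n) (fun n => ?_) ?_)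
  · simp [geodesicRegion, Metric.infDist_zero_of_mem (Set.mem_range_self _)]
  · subst hγ
    exact γ.tendsto_toBoundary.comp tendsto_natCast_atTop_atTop

/-- A liminf is bounded by the values along a ray from `p` to `η`, where the loss is at most `C`. -/
theorem logDilation_le_of_horofunction {X : Type*} [MetricSpace X] [ProperSpace X]
    (hgeod : IsGeodesicSpace X) (hequiv : CompactificationsEquivalent X) {H : X → ℝ}
    {η : GromovBoundary X} (hH : IsHorofunctionAt H η) {g : X → X} {C : ℝ}
    (hg : ∀ x, H (g x) ≤ H x + C) (p : X) : logDilation g η p ≤ C := by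
  obtain ⟨γ, rfl, rfl⟩ := exists_ray hgeod hequiv η p
  refine liminf_le_of_frequently_le' (γ.tendsto_toBoundary.frequently
    (Eventually.of_forall fun t => ?_).frequently)
  have := hH.sub_dist_le hg rfl t
  rw [γ.2.dist_eq]
  exact EReal.coe_le_coe_iff.2 (by simpa [NNReal.dist_eq] using this)

/-- The dilation is the best constant in Julia's lemma. -/
theorem logDilation_le_iff {X : Type*} [MetricSpace X] [ProperSpace X]
    (hgeod : IsGeodesicSpace X) (hequiv : CompactificationsEquivalent X) {H : X → ℝ}
    {η : GromovBoundary X} (hH : IsHorofunctionAt H η) {f : X → X} (hf : LipschitzWith 1 f)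
    (hlim : HasGeodesicLimit (fun x => GromovCompactification.of (f x)) η
      (GromovCompactification.bdry η)) (p : X) (C : ℝ) :
    logDilation f η p ≤ C ↔ ∀ x, H (f x) ≤ H x + C := by
  refine ⟨fun h x => le_of_forall_gt_imp_ge_of_dense fun a ha => ?_,
    fun h => logDilation_le_of_horofunction hgeod hequiv hH h p⟩
  have hfreq : ∃ᶠ z in toBoundary η, z ∈ {z | dist z p - dist (f z) p < a - H x} :=
    (frequently_lt_of_liminf_lt (b := ((a - H x : ℝ) : EReal)) (by isBoundedDefault)
      (h.trans_lt (EReal.coe_lt_coe_iff.2 (by linarith)))).mono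
      fun z hz => EReal.coe_lt_coe_iff.1 hz
  have := frequently_mem_iff_neBot.1 hfreq
  set 𝒰 := Ultrafilter.of (toBoundary η ⊓ 𝓟 {z | dist z p - dist (f z) p < a - H x})
  have h𝒰 : (𝒰 : Filter X) ≤ toBoundary η := (Ultrafilter.of_le _).trans inf_le_left
  have h𝒰' : ∀ᶠ z in (𝒰 : Filter X), dist z p - dist (f z) p < a - H x :=
    (Ultrafilter.of_le _).trans inf_le_right (mem_principal_self _)
  obtain ⟨c, γ, h0, hγ, hc, hcγ⟩ := exists_ray_limit hgeod hequiv p 𝒰 (z := id) (tendsto_id'.2 h𝒰)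
  -- Points almost realising the liminf need not have images tending to `η`, so Julia's lemma cannot
  -- be applied to them. But for non-expanding `f` the loss at a point of a segment from `p` is at
  -- most the loss at its end; the bound thus passes to the limit ray `γ`, where `f` has limit `η`.
  have hbound : ∀ t : ℝ≥0, t - dist (f (γ.1 t)) p ≤ a - H x := fun t => by
    refine le_of_tendsto (tendsto_const_nhds.sub
      (((hf.continuous.tendsto _).comp (hcγ t)).dist tendsto_const_nhds)) ?_
    filter_upwards [h𝒰', ((tendsto_dist_left_cocompact_atTop p).mono_left
      (h𝒰.trans (hequiv.toBoundary_le_cocompact η))).eventually_ge_atTop (t : ℝ)] with z hz htz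
    obtain ⟨-, h1, hiso⟩ := hc z
    have e1 := hiso t htz _ le_rfl
    rw [h1, NNReal.dist_eq, coe_nndist, id, abs_sub_comm, abs_of_nonneg (by linarith)] at e1
    have e2 : dist (f (c z t)) (f z) ≤ dist (c z t) z := by simpa using hf.dist_le_mul (c z t) z
    have e3 := dist_triangle (f z) (f (c z t)) p
    rw [dist_comm (f z) (f (c z t))] at e3
    rw [dist_comm z p] at hz
    simp only [Function.comp_apply]
    linarith
  have hJ := hH.apply_le hf (p := p) (C := a - H x) (l := atTop) (w := fun n : ℕ => γ.1 n)
    (hγ ▸ γ.tendsto_toBoundary.comp tendsto_natCast_atTop_atTop) (hlim.tendsto_ray hγ)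
    (fun n => by
      have := hbound n
      have e : dist (γ.1 n) p = n := by rw [← h0, γ.2.dist_eq]; simp [NNReal.dist_eq]
      rw [e]
      simpa using this) x
  linarith

theorem logDilation_eq {X : Type*} [MetricSpace X] [ProperSpace X]
    (hgeod : IsGeodesicSpace X) (hequiv : CompactificationsEquivalent X)
    {η : GromovBoundary X} {f : X → X} (hf : LipschitzWith 1 f)
    (hlim : HasGeodesicLimit (fun x => GromovCompactification.of (f x)) η
      (GromovCompactification.bdry η)) (p q : X) : logDilation f η p = logDilation f η q := by
  obtain ⟨H, hH⟩ := hequiv.exists_horofunction η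
  have key : ∀ p q : X, logDilation f η p ≤ logDilation f η q := fun p q =>
    EReal.le_of_forall_lt_iff_le.1 fun C hC =>
      (logDilation_le_iff hgeod hequiv hH hf hlim p C).2
        ((logDilation_le_iff hgeod hequiv hH hf hlim q C).1 hC.le)
  exact (key p q).antisymm (key q p)

/-- The loss is at least `-d(f p, p)` everywhere. Together with the finite dilation of a BRFP, this
makes `log λ` a real number. -/
theorem bot_lt_logDilation {X : Type*} [MetricSpace X] {f : X → X} (hf : LipschitzWith 1 f)
    (η : GromovBoundary X) (p : X) : ⊥ < logDilation f η p := by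
  refine (EReal.bot_lt_coe (-dist (f p) p)).trans_le
    (le_liminf_of_le (by isBoundedDefault) (Eventually.of_forall fun z => ?_))
  have h : dist (f z) (f p) ≤ dist z p := by simpa using hf.dist_le_mul z p
  exact EReal.coe_le_coe_iff.2 (by linarith [dist_triangle (f z) (f p) p])

/-! ### Iterates -/

theorem LipschitzWith.one_iterate {X : Type*} [MetricSpace X] {f : X → X}
    (hf : LipschitzWith 1 f) (n : ℕ) : LipschitzWith 1 f^[n] := by
  simpa using hf.iterate n

theorem horofunction_iterate_le {X : Type*} {H : X → ℝ} {f : X → X} {L : ℝ}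
    (hL : ∀ x, H (f x) ≤ H x + L) (n : ℕ) (x : X) : H (f^[n] x) ≤ H x + n * L := by
  induction n with
  | zero => simp
  | succ n ih =>
    rw [Function.iterate_succ_apply']
    push_cast
    linarith [hL (f^[n] x)]

theorem hasGeodesicLimit_iterate {X : Type*} [MetricSpace X] [ProperSpace X]
    (hgeod : IsGeodesicSpace X) (hhyp : IsGromovHyperbolic X)
    (hequiv : CompactificationsEquivalent X) {H : X → ℝ}
    {η : GromovBoundary X} (hH : IsHorofunctionAt H η) {f : X → X} (hf : LipschitzWith 1 f)
    (hlim : HasGeodesicLimit (fun x => GromovCompactification.of (f x)) η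
      (GromovCompactification.bdry η)) {L : ℝ} (hL : ∀ x, H (f x) ≤ H x + L) (n : ℕ) :
    HasGeodesicLimit (fun x => GromovCompactification.of (f^[n] x)) η
      (GromovCompactification.bdry η) := by
  induction n with
  | zero => exact fun γ R _ _ x _ hx => tendsto_comap_iff.1 hx
  | succ n ih =>
    intro γ R hR hγ x hxR hx
    -- As `f^n` is non-expanding, it sends the `R`-region of `γ` into the `(R + K)`-region of `σ`,
    -- where the geodesic limit of `f` applies.
    obtain ⟨σ, K, hσ, hK⟩ := exists_ray_close_to_path hgeod hhyp hequiv (η := η)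
      (y := fun t => f^[n] (γ.1 t)) (by simpa [Function.comp_def] using (hf.one_iterate n).comp γ.2.lipschitz)
      (fun t => hH.sub_dist_le (horofunction_iterate_le hL n) hγ t) (ih.tendsto_ray hγ)
    have hK0 : 0 ≤ K := by
      obtain ⟨s, hs⟩ := hK 0
      exact dist_nonneg.trans hs
    simp only [Function.iterate_succ_apply']
    refine hlim σ (R + K) (by linarith) hσ (fun m => f^[n] (x m)) (fun m => ?_)
      (tendsto_comap_iff.2 (ih γ R hR hγ x hxR hx))
    obtain ⟨_, ⟨t, rfl⟩, ht⟩ := (Metric.infDist_lt_iff (Set.range_nonempty _)).1 (hxR m)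
    obtain ⟨s, hs⟩ := hK t
    refine (Metric.infDist_lt_iff (Set.range_nonempty _)).2 ⟨_, ⟨s, rfl⟩, ?_⟩
    have h1 : dist (f^[n] (x m)) (f^[n] (γ.1 t)) ≤ dist (x m) (γ.1 t) := by
      simpa using (hf.one_iterate n).dist_le_mul (x m) (γ.1 t)
    linarith [dist_triangle (f^[n] (x m)) (f^[n] (γ.1 t)) (σ.1 s)]

/-- The logarithm of the dilation is additive under iteration. -/
theorem logDilation_iterate {X : Type*} [MetricSpace X] [ProperSpace X]
    (hgeod : IsGeodesicSpace X) (hhyp : IsGromovHyperbolic X)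
    (hequiv : CompactificationsEquivalent X) {η : GromovBoundary X} {f : X → X}
    (hf : LipschitzWith 1 f)
    (hlim : HasGeodesicLimit (fun x => GromovCompactification.of (f x)) η
      (GromovCompactification.bdry η)) {p : X} {L : ℝ} (hL : logDilation f η p = L) (n : ℕ) :
    HasGeodesicLimit (fun x => GromovCompactification.of (f^[n] x)) η
      (GromovCompactification.bdry η) ∧ logDilation f^[n] η p = ((n * L : ℝ) : EReal) := by
  obtain ⟨H, hH⟩ := hequiv.exists_horofunction η
  have hHL := (logDilation_le_iff hgeod hequiv hH hf hlim p L).1 hL.le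
  have hlimn := hasGeodesicLimit_iterate hgeod hhyp hequiv hH hf hlim hHL
  refine ⟨hlimn n, le_antisymm (logDilation_le_of_horofunction hgeod hequiv hH
    (horofunction_iterate_le hHL n) p) (EReal.le_of_forall_lt_iff_le.1 fun C hC => ?_)⟩
  have hHC := (logDilation_le_iff hgeod hequiv hH (hf.one_iterate n) (hlimn n) p C).1 hC.le
  obtain ⟨γ, rfl, hγ⟩ := exists_ray hgeod hequiv η p
  have hlow : ∀ a < L, n * a ≤ C := fun a ha => by
    have hev : ∀ᶠ z in toBoundary η, a < dist z (γ.1 0) - dist (f z) (γ.1 0) :=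
      (eventually_lt_of_lt_liminf (b := (a : EReal))
        (by rw [← logDilation, hL]; exact EReal.coe_lt_coe_iff.2 ha)).mono
        fun z hz => EReal.coe_lt_coe_iff.1 hz
    -- Only finitely many `k` occur, so one `m` serves all the terms of the telescoping sum.
    obtain ⟨m, hm⟩ := ((Finset.range n).eventually_all.2 fun k _ =>
      ((hlimn k).tendsto_ray hγ).eventually hev).exists
    have hsum := Finset.card_nsmul_le_sum _ _ a fun k hk => (hm k hk).le
    simp only [← Function.iterate_succ_apply' f] at hsum
    rw [Finset.sum_range_sub' fun k => dist (f^[k] (γ.1 m)) (γ.1 0), Finset.card_range,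
      nsmul_eq_mul, Function.iterate_zero_apply, γ.2.dist_eq] at hsum
    have := hH.sub_dist_le hHC hγ m
    simp only [NNReal.dist_eq, NNReal.coe_natCast, NNReal.coe_zero, sub_zero, Nat.abs_cast]
      at hsum this
    linarith
  -- Letting `a` increase to `L` turns `n * a ≤ C` into `n * L ≤ C`, without dividing by `n`.
  refine EReal.coe_le_coe_iff.2 (le_of_tendsto (f := fun a : ℝ => n * a) (x := 𝓝[<] L) ?_
    (eventually_mem_nhdsWithin.mono hlow))
  exact ((continuous_const.mul continuous_id).tendsto L).mono_left nhdsWithin_le_nhds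

theorem mainTheorem8 {X : Type*} [MetricSpace X] [ProperSpace X]
    (hgeod : IsGeodesicSpace X) (hhyp : IsGromovHyperbolic X)
    (hequiv : CompactificationsEquivalent X)
    (f : X → X) (hf : LipschitzWith 1 f) (η : GromovBoundary X) (hη : IsBRFP f η) :
    -- the dilation does not depend on the base point, so `λ_η(f)` makes sense
    (∀ p q : X, dilation f η p = dilation f η q) ∧
    -- `η` is a BRFP of every iterate, and `λ_η(f^n) = λ_η(f)^n`
    (∀ n : ℕ, 1 ≤ n → IsBRFP f^[n] η ∧ ∀ p : X, dilation f^[n] η p = dilation f η p ^ n) ∧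
    -- the limit defining the stable dilation exists, and `Λ_η(f) = λ_η(f)`
    (∀ p : X, Tendsto (fun n : ℕ => logDilation f^[n] η p / (n : EReal)) atTop
        (𝓝 (logDilation f η p)) ∧
      stableDilation f η p = dilation f η p) := by
  obtain ⟨⟨p₀, hp₀⟩, hlim⟩ := hη
  have hindep := logDilation_eq hgeod hequiv hf hlim
  obtain ⟨L, hL⟩ : ∃ L : ℝ, ∀ p, logDilation f η p = L := by
    refine ⟨(logDilation f η p₀).toReal, fun p => ?_⟩
    rw [hindep p p₀, EReal.coe_toReal (fun h => ?_) (bot_lt_logDilation hf η p₀).ne']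
    rw [dilation, h, EReal.exp_top] at hp₀
    exact hp₀.ne rfl
  have hiter := fun p n => logDilation_iterate hgeod hhyp hequiv hf hlim (hL p) n
  have hdil : ∀ p (n : ℕ), dilation f^[n] η p = dilation f η p ^ n := fun p n => by
    rw [dilation, dilation, (hiter p n).2, hL, EReal.exp_coe, EReal.exp_coe, Real.exp_nat_mul,
      ENNReal.ofReal_pow (Real.exp_pos _).le]
  have htend : ∀ p, Tendsto (fun n : ℕ => logDilation f^[n] η p / (n : EReal)) atTop
      (𝓝 (logDilation f η p)) := fun p => by
    refine tendsto_const_nhds.congr' ?_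
    -- The sequence is constant from `n = 1` on; only the division by zero at `n = 0` is discarded.
    filter_upwards [eventually_ge_atTop 1] with n hn
    have hn' : (n : ℝ) ≠ 0 := by exact_mod_cast Nat.one_le_iff_ne_zero.1 hn
    have : ((n : ℕ) : EReal) = ((n : ℝ) : EReal) := by simp
    rw [(hiter p n).2, hL, this, ← EReal.coe_div, mul_div_cancel_left₀ L hn']
  refine ⟨fun p q => by rw [dilation, dilation, hindep p q],
    fun n _ => ⟨⟨⟨p₀, ?_⟩, (hiter p₀ n).1⟩, fun p => hdil p n⟩, fun p => ⟨htend p, ?_⟩⟩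
  · rw [hdil]
    exact ENNReal.pow_lt_top hp₀
  · rw [stableDilation, (htend p).limUnder_eq, dilation]
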